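/- Let $n\ge 2$. On $\mathbb{R}^{2n+2}$, with the Euclidean inner product $\langle\cdot,\cdot\rangle$ and coordinates $(x,y)$, $x,y\in\mathbb{R}^{n+1}$, let $\mathcal{I}(x,y)=(-y,x)$ be the usual complex structure. Let $\mathbb{S}^{2n+1}\subset\mathbb{R}^{2n+2}$ be the unit sphere with its induced metric, Levi-Civita connection $\nabla$, curvature operator $R(X,Y)=\nabla_X\nabla_Y-\nabla_Y\nabla_X-\nabla_{[X,Y]}$, and its standard contact form $\eta_p(v)=\langle v,-\mathcal{I}p\rangle$. Let $I\subseteq\mathbb{R}$ be an open interval and let $\gamma:I\to\mathbb{S}^{2n+1}$ be a smooth curve parametrized by arc length, with $T=\gamma'$. Suppose that $\gamma$ is a Legendre curve, i.e. $\eta(\gamma')=0$ on $I$, and that it is proper-biharmonic, i.e. its tension field $\tau(\gamma)=\nabla_TT$ does not vanish identically, while its bitension field $$\tau_2(\gamma)=\nabla_T^3T-R(T,\nabla_TT)T$$ vanishes identically. Then one of the following holds. 1. There are constant vectors $e_1,e_2,e_3\in\mathbb{R}^{2n+2}$ such that the six vectors $e_1,e_2,e_3,\mathcal{I}e_1,\mathcal{I}e_2,\mathcal{I}e_3$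 are orthonormal and, for all $s\in I$, $$\gamma(s)=\frac{1}{\sqrt2}\cos(\sqrt2\,s)\,e_1+\frac{1}{\sqrt2}\sin(\sqrt2\,s)\,e_2+\frac{1}{\sqrt2}\,e_3 .$$ 2. The first curvature $\|\nabla_TT\|$ of $\gamma$ is a constant $\kappa_1\in(0,1)$ and, with $A=\sqrt{1+\kappa_1}$ and $B=\sqrt{1-\kappa_1}$, there are constant orthonormal vectors $e_1,e_2,e_3,e_4\in\mathbb{R}^{2n+2}$ such that $$\langle e_1,\mathcal{I}e_3\rangle=\langle e_1,\mathcal{I}e_4\rangle=\langle e_2,\mathcal{I}e_3\rangle=\langle e_2,\mathcal{I}e_4\rangle=0,\qquad A\langle e_1,\mathcal{I}e_2\rangle+B\langle e_3,\mathcal{I}e_4\rangle=0,$$ and, for all $s\in I$, $$\gamma(s)=\frac{1}{\sqrt2}\cos(As)\,e_1+\frac{1}{\sqrt2}\sin(As)\,e_2+\frac{1}{\sqrt2}\cos(Bs)\,e_3+\frac{1}{\sqrt2}\sin(Bs)\,e_4 .$$ -/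

import Mathlib

open scoped ContDiff

namespace LegendreSphere

/-- The Euclidean space `ℝ^{2n+2}`, with coordinates
`(x, y) = (x¹, …, xⁿ⁺¹, y¹, …, yⁿ⁺¹)`. -/
abbrev E (n : ℕ) : Type := EuclideanSpace ℝ (Fin (n + 1) ⊕ Fin (n + 1))

/-- The usual complex structure of `ℝ^{2n+2}`: `J (x, y) = (-y, x)`. -/
noncomputable def J (n : ℕ) : E n →ₗ[ℝ] E n where
  toFun v := WithLp.toLp 2 (Sum.elim (fun i => -v (Sum.inr i)) (fun i => v (Sum.inl i)))
  map_add' u v := by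
    ext i
    rcases i with i | i <;> simp [add_comm]
  map_smul' c v := by
    ext i
    rcases i with i | i <;> simp

/-- The characteristic vector field `ξ` of the standard Sasakian structure of the unit sphere
`S^{2n+1}`: `ξ_p = -J p`. -/
noncomputable def reeb (n : ℕ) (p : E n) : E n := -(J n p)

/-- The contact form `η` of the standard Sasakian structure of the unit sphere `S^{2n+1}`:
`η_p(v) = ⟨v, ξ_p⟩`. -/
noncomputable def contactForm (n : ℕ) (p v : E n) : ℝ := inner ℝ v (reeb n p)

/-- For a point `p` of the unit sphere, the orthogonal projection of `ℝ^{2n+2}` onto the tangent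
space `p^⊥` of the sphere at `p`. -/
noncomputable def tangentProj {n : ℕ} (p v : E n) : E n := v - inner ℝ v p • p

/-- The Levi-Civita connection of the unit sphere (with the metric induced from `ℝ^{2n+2}`), for
tangent vector fields given by extensions to `ℝ^{2n+2}`: `∇_X Y` is the tangential part of the
directional derivative of `Y` along `X`. -/
noncomputable def conn {n : ℕ} (X Y : E n → E n) (p : E n) : E n :=
  tangentProj p (fderiv ℝ Y p (X p))

/-- The tangent vector field `q ↦ tangentProj q x` on the sphere. It takes the value `x` at `p`
when `x` is tangent to the sphere at `p`. -/
noncomputable def extend {n : ℕ} (x : E n) : E n → E n := fun q => tangentProj q x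

/-- The curvature operator `R(X, Y) Z = ∇_X ∇_Y Z - ∇_Y ∇_X Z - ∇_{[X, Y]} Z` of the unit sphere,
at a point `p` and tangent vectors `x`, `y`, `z` at `p`; it is computed on tangent vector fields
`X`, `Y`, `Z` that extend `x`, `y`, `z`. -/
noncomputable def curvature {n : ℕ} (p x y z : E n) : E n :=
  conn (extend x) (conn (extend y) (extend z)) p
    - conn (extend y) (conn (extend x) (extend z)) p
    - conn (VectorField.lieBracket ℝ (extend x) (extend y)) (extend z) p

/-- The covariant derivative `∇_{∂/∂s} V`, along a curve `γ` in the unit sphere, of a vector field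
`V` along `γ` tangent to the sphere: the tangential part of `V'`. -/
noncomputable def covDeriv {n : ℕ} (γ V : ℝ → E n) (s : ℝ) : E n :=
  tangentProj (γ s) (deriv V s)

/-- The tension field `τ(γ) = trace ∇dγ = ∇_{∂/∂s} γ'` of a curve `γ` in the unit sphere. -/
noncomputable def tension {n : ℕ} (γ : ℝ → E n) : ℝ → E n := covDeriv γ (deriv γ)

/-- The bitension field `τ₂(γ) = -Δτ(γ) - trace R(dγ, τ(γ)) dγ`, that is,
`∇∇τ(γ) - R(γ', τ(γ)) γ'`, of a curve `γ` in the unit sphere. -/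
noncomputable def bitension {n : ℕ} (γ : ℝ → E n) (s : ℝ) : E n :=
  covDeriv γ (covDeriv γ (tension γ)) s - curvature (γ s) (deriv γ s) (tension γ s) (deriv γ s)

/-- `γ` is harmonic on `I`. -/
def IsHarmonic {n : ℕ} (γ : ℝ → E n) (I : Set ℝ) : Prop := ∀ s ∈ I, tension γ s = 0

/-- `γ` is biharmonic on `I`. -/
def IsBiharmonic {n : ℕ} (γ : ℝ → E n) (I : Set ℝ) : Prop := ∀ s ∈ I, bitension γ s = 0

/-- `γ` is proper-biharmonic on `I`: biharmonic and not harmonic. -/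
def IsProperBiharmonic {n : ℕ} (γ : ℝ → E n) (I : Set ℝ) : Prop :=
  IsBiharmonic γ I ∧ ¬ IsHarmonic γ I

/-- `γ` is a Legendre curve on `I`: an integral curve of the contact distribution `η = 0`. -/
def IsLegendre {n : ℕ} (γ : ℝ → E n) (I : Set ℝ) : Prop :=
  ∀ s ∈ I, contactForm n (γ s) (deriv γ s) = 0

/-- The first curvature `κ₁(s) = ‖∇_T T‖`, `T = γ'`, of a curve `γ` in the unit sphere
parametrized by arc length. -/
noncomputable def firstCurvature {n : ℕ} (γ : ℝ → E n) (s : ℝ) : ℝ := ‖covDeriv γ (deriv γ) s‖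

end LegendreSphere

namespace LegendreSphere

/-! ### Complex structure and curvature of the sphere. -/

section Sphere

variable {n : ℕ}

/-! Write `T = γ'`, `τ = ∇_T T` and `N = τ'` in the ambient space. The sphere has curvature one
(`curvature_eq`), so biharmonicity reads `N' = |τ|² γ - τ`. Differentiating inner products shows
that `|τ| = κ` is constant, so `γ'' = τ - γ` and `τ'' = κ² γ - τ` is a linear system with constant
coefficients (`exists_frame_equations`). For `κ > 0` it decouples: `γ - τ/κ` and `γ + τ/κ` are
eigenvectors of the second derivative, with eigenvalues `-(1 + κ)` and `-(1 - κ)`, and `γ` is half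
their sum. Cauchy-Schwarz for `N` and `T` gives `κ ≤ 1`. If `κ < 1`, both components rotate; if `κ =
1`, the second is constant (`exists_rotating_component` handles the rotations).

Differentiating the Legendre condition leaves a single undetermined Kähler pairing, `⟨τ, J T⟩`
(`inner_J_frame`). It gives opposite contributions to `A⟨e₁, J e₂⟩` and `B⟨e₃, J e₄⟩`, and it
vanishes when `κ = 1`. The remaining relations are Gram computations at one parameter value. -/

theorem inner_J_left (u v : E n) : inner ℝ (J n u) v = -inner ℝ u (J n v) := by
  simp [J, PiLp.inner_apply, Fintype.sum_sum_type, Finset.sum_neg_distrib, add_comm]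

theorem J_J (u : E n) : J n (J n u) = -u := by
  ext i
  rcases i with i | i <;> simp [J]

theorem inner_J_self (u : E n) : inner ℝ u (J n u) = 0 := by
  have h := inner_J_left u u
  rw [real_inner_comm] at h
  linarith

theorem inner_J_comm (u v : E n) : inner ℝ u (J n v) = -inner ℝ v (J n u) := by
  rw [← inner_J_left, real_inner_comm]

theorem hasFDerivAt_extend (z q : E n) :
    HasFDerivAt (extend z)
      (-(inner ℝ z q • ContinuousLinearMap.id ℝ (E n) + (innerSL ℝ z).smulRight q)) q := by
  have h := ((innerSL ℝ z).hasFDerivAt (x := q)).smul (hasFDerivAt_id (𝕜 := ℝ) q)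
  exact h.const_sub z

theorem fderiv_extend_apply (z q v : E n) :
    fderiv ℝ (extend z) q v = -(inner ℝ z q • v + inner ℝ z v • q) := by
  simp [(hasFDerivAt_extend z q).fderiv]

theorem differentiable_extend (z : E n) : Differentiable ℝ (extend z) :=
  fun q => (hasFDerivAt_extend z q).differentiableAt

theorem extend_of_inner_eq_zero {p x : E n} (hx : inner ℝ x p = 0) : extend x p = x := by
  simp [extend, tangentProj, hx]

/-- At `p` the derivative of `extend z` is purely normal, whatever the direction. As `W` is
arbitrary, the bracket term of the curvature drops out without computing the bracket. -/
theorem conn_extend_of_tangent (W : E n → E n) {p z : E n} (hp : inner ℝ p p = 1)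
    (hz : inner ℝ z p = 0) : conn W (extend z) p = 0 := by
  simp only [conn, fderiv_extend_apply, tangentProj, hz, zero_smul, zero_add, inner_neg_left,
    inner_smul_left, hp]
  simp

/-- Valid for every ambient `q`, since the field is differentiated again in the ambient space. The
factor `1 - ⟨q, q⟩` isolates the part that is zero on the sphere. -/
theorem conn_extend_extend (y z q : E n) :
    conn (extend y) (extend z) q =
      inner ℝ z q • -tangentProj q (extend y q)
        + (1 - inner ℝ q q) • -(inner ℝ z (extend y q) • q) := by
  simp only [conn, fderiv_extend_apply, tangentProj, inner_neg_left, inner_add_left,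
    real_inner_smul_left]
  module

theorem conn_conn_extend {p x y z : E n} (hp : inner ℝ p p = 1) (hx : inner ℝ x p = 0)
    (hy : inner ℝ y p = 0) (hz : inner ℝ z p = 0) :
    conn (extend x) (conn (extend y) (extend z)) p = -(inner ℝ z x • y) := by
  have hd := differentiable_extend y
  have h₁ : HasFDerivAt (fun q : E n => inner ℝ z q) (innerSL ℝ z) p := (innerSL ℝ z).hasFDerivAt
  have h₂ : HasFDerivAt (fun q : E n => 1 - inner ℝ q q) (-(2 • innerSL ℝ p)) p := by
    have h := ((hasStrictFDerivAt_norm_sq p).hasFDerivAt).const_sub 1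
    simpa only [real_inner_self_eq_norm_sq] using h
  have h₃ : DifferentiableAt ℝ (fun q : E n => -tangentProj q (extend y q)) p :=
     ((hd p).sub (((hd p).inner ℝ differentiableAt_id).smul differentiableAt_id)).neg
  have h₄ : DifferentiableAt ℝ (fun q : E n => -(inner ℝ z (extend y q) • q)) p :=
    (((differentiableAt_const z).inner ℝ (hd p)).smul differentiableAt_id).neg
  -- Both scalar factors vanish at `p`, so only their derivatives count; that of `1 - ⟨q, q⟩` is
  -- zero along the tangent vector `x`.
  have h := (h₁.smul h₃.hasFDerivAt).add (h₂.smul h₄.hasFDerivAt)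
  have e : conn (extend y) (extend z) = _ := funext (conn_extend_extend y z)
  have hpx : inner ℝ p x = 0 := by rw [real_inner_comm, hx]
  rw [conn, e, extend_of_inner_eq_zero hx]
  erw [h.fderiv]
  simp [hz, hp, hpx, extend_of_inner_eq_zero hy, tangentProj, hy, inner_neg_left,
    real_inner_smul_left, -inner_self_eq_norm_sq_to_K]

/-- The unit sphere has constant curvature one. -/
theorem curvature_eq {p x y z : E n} (hp : inner ℝ p p = 1) (hx : inner ℝ x p = 0)
    (hy : inner ℝ y p = 0) (hz : inner ℝ z p = 0) :
    curvature p x y z = inner ℝ z y • x - inner ℝ z x • y := by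
  rw [curvature, conn_conn_extend hp hx hy hz, conn_conn_extend hp hy hx hz,
    conn_extend_of_tangent _ hp hz]
  module

end Sphere

/-! ### Constant inner products and rotating pairs of vectors. -/

section Curves

variable {V : Type*} [NormedAddCommGroup V] [InnerProductSpace ℝ V] {I : Set ℝ}

theorem deriv_inner_eq_zero (hI : IsOpen I) {u v u' v' : ℝ → V}
    (hu : ∀ s ∈ I, HasDerivAt u (u' s) s) (hv : ∀ s ∈ I, HasDerivAt v (v' s) s) {c : ℝ}
    (h : ∀ s ∈ I, inner ℝ (u s) (v s) = c) :
    ∀ s ∈ I, inner ℝ (u s) (v' s) + inner ℝ (u' s) (v s) = 0 := by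
  intro s hs
  have h₁ := (hu s hs).inner ℝ (hv s hs)
  have h₂ : (fun t => inner ℝ (u t) (v t)) =ᶠ[nhds s] fun _ => c :=
    Filter.eventually_of_mem (hI.mem_nhds hs) h
  exact h₁.unique ((hasDerivAt_const s c).congr_of_eventuallyEq h₂)

theorem exists_const_of_hasDerivAt_zero (hI : IsOpen I) (hI' : I.OrdConnected) {W : Type*}
    [NormedAddCommGroup W] [NormedSpace ℝ W] {f : ℝ → W}
    (hf : ∀ s ∈ I, HasDerivAt f 0 s) : ∃ e, ∀ s ∈ I, f s = e :=
  hI.exists_is_const_of_deriv_eq_zero hI'.isPreconnected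
    (fun s hs => (hf s hs).differentiableAt.differentiableWithinAt) fun s hs => (hf s hs).deriv

/-- The solutions of `u' = A w`, `w' = -A u` are rotating pairs of vectors. -/
theorem exists_rotating_frame (hI : IsOpen I) (hI' : I.OrdConnected) (A : ℝ) {u w : ℝ → V}
    (hu : ∀ s ∈ I, HasDerivAt u (A • w s) s) (hw : ∀ s ∈ I, HasDerivAt w (-(A • u s)) s) :
    ∃ e f : V, ∀ s ∈ I, e = Real.cos (A * s) • u s - Real.sin (A * s) • w s ∧
      f = Real.sin (A * s) • u s + Real.cos (A * s) • w s := by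
  have hm : ∀ s : ℝ, HasDerivAt (fun t => A * t) A s := fun s => by
    simpa using (hasDerivAt_id s).const_mul A
  -- Turning the pair back by the angle `A * s` cancels its motion, so the result has zero
  -- derivative.
  obtain ⟨e, he⟩ := exists_const_of_hasDerivAt_zero hI hI'
    (f := fun s => Real.cos (A * s) • u s - Real.sin (A * s) • w s) (by
      intro s hs
      refine (((hm s).cos.smul (hu s hs)).sub ((hm s).sin.smul (hw s hs))).congr_deriv ?_
      module)
  obtain ⟨f, hf⟩ := exists_const_of_hasDerivAt_zero hI hI'
    (f := fun s => Real.sin (A * s) • u s + Real.cos (A * s) • w s) (by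
      intro s hs
      refine (((hm s).sin.smul (hu s hs)).add ((hm s).cos.smul (hw s hs))).congr_deriv ?_
      module)
  exact ⟨e, f, fun s hs => ⟨(he s hs).symm, (hf s hs).symm⟩⟩

theorem cos_smul_add_sin_smul_frame {θ : ℝ} {u w e f : V}
    (he : e = Real.cos θ • u - Real.sin θ • w) (hf : f = Real.sin θ • u + Real.cos θ • w) :
    Real.cos θ • e + Real.sin θ • f = u := by
  have h : Real.cos θ • e + Real.sin θ • f = (Real.sin θ ^ 2 + Real.cos θ ^ 2) • u := by
    rw [he, hf]; module
  rw [h, Real.sin_sq_add_cos_sq, one_smul]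

theorem orthonormal_frame {θ : ℝ} {u w e f : V} (he : e = Real.cos θ • u - Real.sin θ • w)
    (hf : f = Real.sin θ • u + Real.cos θ • w) (huu : inner ℝ u u = (1 : ℝ))
    (hww : inner ℝ w w = (1 : ℝ)) (huw : inner ℝ u w = (0 : ℝ)) :
    inner ℝ e e = (1 : ℝ) ∧ inner ℝ f f = (1 : ℝ) ∧ inner ℝ e f = (0 : ℝ) := by
  have hwu : inner ℝ w u = (0 : ℝ) := by rw [real_inner_comm, huw]
  have h := Real.sin_sq_add_cos_sq θ
  simp only [he, hf, inner_add_left, inner_add_right, inner_sub_left, inner_sub_right,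
    real_inner_smul_left, real_inner_smul_right, huu, hww, huw, hwu]
  exact ⟨by linarith, by linarith, by ring⟩

theorem inner_frame_eq_zero {θ : ℝ} {u w e f x : V}
    (he : e = Real.cos θ • u - Real.sin θ • w) (hf : f = Real.sin θ • u + Real.cos θ • w)
    (hu : inner ℝ u x = (0 : ℝ)) (hw : inner ℝ w x = (0 : ℝ)) :
    inner ℝ e x = (0 : ℝ) ∧ inner ℝ f x = (0 : ℝ) := by
  simp [he, hf, inner_add_left, inner_sub_left, real_inner_smul_left, hu, hw]

end Curves

/-- The Kähler form is alternating, hence unchanged by a rotation of determinant one in the plane of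
`u` and `w`. -/
theorem inner_J_frame_pair {n : ℕ} {θ : ℝ} {u w e f : E n}
    (he : e = Real.cos θ • u - Real.sin θ • w) (hf : f = Real.sin θ • u + Real.cos θ • w) :
    inner ℝ e (J n f) = (inner ℝ u (J n w) : ℝ) := by
  have h := Real.sin_sq_add_cos_sq θ
  simp only [he, hf, inner_add_right, inner_sub_left, real_inner_smul_left,
    real_inner_smul_right, map_add, map_smul, inner_J_self, inner_J_comm w u]
  linear_combination (inner ℝ u (J n w) : ℝ) * h

/-! ### The linear system of a biharmonic curve and its Kähler pairings. -/

variable {n : ℕ} {I : Set ℝ} {γ : ℝ → E n}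

theorem deriv_inner_J_eq_zero (hI : IsOpen I) {u v u' v' : ℝ → E n}
    (hu : ∀ s ∈ I, HasDerivAt u (u' s) s) (hv : ∀ s ∈ I, HasDerivAt v (v' s) s) {c : ℝ}
    (h : ∀ s ∈ I, inner ℝ (u s) (J n (v s)) = c) :
    ∀ s ∈ I, inner ℝ (u s) (J n (v' s)) + inner ℝ (u' s) (J n (v s)) = 0 :=
  deriv_inner_eq_zero hI hu (v := fun s => J n (v s)) (v' := fun s => J n (v' s))
    (fun s hs => (J n).toContinuousLinearMap.hasFDerivAt.comp_hasDerivAt s (hv s hs)) h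

theorem hasDerivAt_deriv_of_contDiffOn (hI : IsOpen I) {f : ℝ → E n} (hf : ContDiffOn ℝ ∞ f I) :
    (∀ s ∈ I, HasDerivAt f (deriv f s) s) ∧ ContDiffOn ℝ ∞ (deriv f) I :=
  ⟨fun s hs => ((hf.contDiffAt (hI.mem_nhds hs)).differentiableAt (by simp)).hasDerivAt,
    hf.deriv_of_isOpen hI (by simp)⟩

/-- A biharmonic curve `γ` in the unit sphere, parametrized by arc length, has constant first
curvature, and its derivatives satisfy a linear system. -/
theorem exists_frame_equations (hI : IsOpen I) (hI' : I.OrdConnected)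
    (hne : I.Nonempty) (hγ : ContDiffOn ℝ ∞ γ I) (hS : ∀ s ∈ I, inner ℝ (γ s) (γ s) = (1 : ℝ))
    (hT : ∀ s ∈ I, inner ℝ (deriv γ s) (deriv γ s) = (1 : ℝ)) (hb : IsBiharmonic γ I) :
    ∃ (κ : ℝ) (N : ℝ → E n), 0 ≤ κ ∧ (∀ s ∈ I, firstCurvature γ s = κ) ∧
      (∀ s ∈ I, HasDerivAt γ (deriv γ s) s) ∧
      (∀ s ∈ I, HasDerivAt (deriv γ) (tension γ s - γ s) s) ∧
      (∀ s ∈ I, HasDerivAt (tension γ) (N s) s) ∧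
      (∀ s ∈ I, HasDerivAt N (κ ^ 2 • γ s - tension γ s) s) ∧
      ∀ s ∈ I, inner ℝ (deriv γ s) (γ s) = (0 : ℝ) ∧ inner ℝ (tension γ s) (γ s) = (0 : ℝ) ∧
        inner ℝ (tension γ s) (deriv γ s) = (0 : ℝ) ∧
        inner ℝ (tension γ s) (tension γ s) = κ ^ 2 ∧ inner ℝ (N s) (γ s) = (0 : ℝ) ∧
        inner ℝ (N s) (deriv γ s) = -κ ^ 2 ∧ inner ℝ (N s) (tension γ s) = (0 : ℝ) ∧
        inner ℝ (N s) (N s) = κ ^ 2 := by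
  obtain ⟨dγ, cT⟩ := hasDerivAt_deriv_of_contDiffOn hI hγ
  obtain ⟨dT', cT'⟩ := hasDerivAt_deriv_of_contDiffOn hI cT
  have hTγ : ∀ s ∈ I, inner ℝ (deriv γ s) (γ s) = (0 : ℝ) := fun s hs => by
    have h := deriv_inner_eq_zero hI dγ dγ hS s hs
    rw [real_inner_comm] at h
    linarith
  have hT'T : ∀ s ∈ I, inner ℝ (deriv (deriv γ) s) (deriv γ s) = (0 : ℝ) := fun s hs => by
    have h := deriv_inner_eq_zero hI dT' dT' hT s hs
    rw [real_inner_comm] at h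
    linarith
  have hT'γ : ∀ s ∈ I, inner ℝ (deriv (deriv γ) s) (γ s) = (-1 : ℝ) := fun s hs => by
    have h := deriv_inner_eq_zero hI dT' dγ hTγ s hs
    rw [hT s hs] at h
    linarith
  have τeq : ∀ s ∈ I, tension γ s = deriv (deriv γ) s + γ s := fun s hs => by
    simp [tension, covDeriv, tangentProj, hT'γ s hs]
  have cτ : ContDiffOn ℝ ∞ (tension γ) I := (cT'.add hγ).congr τeq
  have dT : ∀ s ∈ I, HasDerivAt (deriv γ) (tension γ s - γ s) s := fun s hs => by
    rw [τeq s hs, add_sub_cancel_right]; exact dT' s hs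
  obtain ⟨dτ, cN⟩ := hasDerivAt_deriv_of_contDiffOn hI cτ
  obtain ⟨dN', -⟩ := hasDerivAt_deriv_of_contDiffOn hI cN
  set T := deriv γ
  set τ := tension γ with hτ
  set N := deriv τ
  have hτγ : ∀ s ∈ I, inner ℝ (τ s) (γ s) = (0 : ℝ) := fun s hs => by
    rw [τeq s hs, inner_add_left, hT'γ s hs, hS s hs]; norm_num
  have hτT : ∀ s ∈ I, inner ℝ (τ s) (T s) = (0 : ℝ) := fun s hs => by
    rw [τeq s hs, inner_add_left, hT'T s hs, real_inner_comm, hTγ s hs]; norm_num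
  have hNγ : ∀ s ∈ I, inner ℝ (N s) (γ s) = (0 : ℝ) := fun s hs => by
    have h := deriv_inner_eq_zero hI dτ dγ hτγ s hs
    rw [hτT s hs] at h
    linarith
  have hNT : ∀ s ∈ I, inner ℝ (N s) (T s) = -inner ℝ (τ s) (τ s) := fun s hs => by
    have h := deriv_inner_eq_zero hI dτ dT hτT s hs
    rw [inner_sub_right, hτγ s hs] at h
    linarith
  have hN'γ : ∀ s ∈ I, inner ℝ (deriv N s) (γ s) = inner ℝ (τ s) (τ s) := fun s hs => by
    have h := deriv_inner_eq_zero hI dN' dγ hNγ s hs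
    rw [hNT s hs] at h
    linarith
  have cov : ∀ s ∈ I, covDeriv γ τ s = N s := fun s hs => by
    change tangentProj (γ s) (N s) = N s
    simp [tangentProj, hNγ s hs]
  have covcov : ∀ s ∈ I, covDeriv γ (covDeriv γ τ) s = deriv N s - inner ℝ (τ s) (τ s) • γ s :=
    fun s hs => by
      have h : covDeriv γ τ =ᶠ[nhds s] N := Filter.eventually_of_mem (hI.mem_nhds hs) cov
      rw [covDeriv, h.deriv_eq, tangentProj, hN'γ s hs]
  have N'eq : ∀ s ∈ I, deriv N s = inner ℝ (τ s) (τ s) • γ s - τ s := fun s hs => by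
    have h := hb s hs
    have hTτ : inner ℝ (T s) (τ s) = (0 : ℝ) := by rw [real_inner_comm, hτT s hs]
    rw [bitension, curvature_eq (hS s hs) (hTγ s hs) (hτγ s hs) (hTγ s hs), covcov s hs, hT s hs,
      hTτ] at h
    rw [← sub_eq_zero, ← h]
    module
  -- Differentiating `⟨N, T⟩ + ⟨τ, τ⟩ = 0` and inserting the equation for `N'` leaves `3⟨N, τ⟩ = 0`;
  -- this is what makes `|τ|` constant.
  have hNτ : ∀ s ∈ I, inner ℝ (N s) (τ s) = (0 : ℝ) := fun s hs => by
    have d : HasDerivAt (fun t => inner ℝ (N t) (T t) + inner ℝ (τ t) (τ t)) _ s :=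
      ((dN' s hs).inner ℝ (dT s hs)).add ((dτ s hs).inner ℝ (dτ s hs))
    have e : (fun t => inner ℝ (N t) (T t) + inner ℝ (τ t) (τ t)) =ᶠ[nhds s] fun _ => (0 : ℝ) :=
      Filter.eventually_of_mem (hI.mem_nhds hs) fun t ht => by
        simp only [hNT t ht]; ring
    have h := d.unique ((hasDerivAt_const s (0 : ℝ)).congr_of_eventuallyEq e)
    rw [N'eq s hs, inner_sub_right, hNγ s hs, inner_sub_left, hτT s hs, real_inner_smul_left,
      real_inner_comm (T s) (γ s), hTγ s hs, real_inner_comm (N s) (τ s)] at h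
    linarith
  obtain ⟨k, hk⟩ := exists_const_of_hasDerivAt_zero hI hI' (f := fun s => inner ℝ (τ s) (τ s))
    fun s hs => ((dτ s hs).inner ℝ (dτ s hs)).congr_deriv (by
      rw [real_inner_comm, hNτ s hs, add_zero])
  have hk0 : 0 ≤ k := by
    obtain ⟨s, hs⟩ := hne
    rw [← hk s hs]
    exact real_inner_self_nonneg
  have hNN : ∀ s ∈ I, inner ℝ (N s) (N s) = k := fun s hs => by
    have h := deriv_inner_eq_zero hI dN' dτ hNτ s hs
    rw [N'eq s hs, inner_sub_left, real_inner_smul_left, real_inner_comm (τ s) (γ s), hτγ s hs,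
      hk s hs] at h
    linarith
  refine ⟨√k, N, Real.sqrt_nonneg k, fun s hs => ?_, dγ, dT, dτ, fun s hs => ?_, fun s hs => ?_⟩
  · change ‖τ s‖ = √k
    rw [norm_eq_sqrt_real_inner, hk s hs]
  · rw [Real.sq_sqrt hk0, ← hk s hs, ← N'eq s hs]
    exact dN' s hs
  · rw [Real.sq_sqrt hk0]
    exact ⟨hTγ s hs, hτγ s hs, hτT s hs, hk s hs, hNγ s hs, by rw [hNT s hs, hk s hs], hNτ s hs,
      hNN s hs⟩

/-- The Kähler form on the derivatives of a biharmonic Legendre curve. -/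
theorem inner_J_frame (hI : IsOpen I) {κ : ℝ} {T τ N : ℝ → E n}
    (dγ : ∀ s ∈ I, HasDerivAt γ (T s) s) (dT : ∀ s ∈ I, HasDerivAt T (τ s - γ s) s)
    (dτ : ∀ s ∈ I, HasDerivAt τ (N s) s)
    (dN : ∀ s ∈ I, HasDerivAt N (κ ^ 2 • γ s - τ s) s)
    (hL : ∀ s ∈ I, inner ℝ (T s) (J n (γ s)) = (0 : ℝ)) :
    ∀ s ∈ I, inner ℝ (τ s) (J n (γ s)) = (0 : ℝ) ∧
      inner ℝ (N s) (J n (γ s)) = -(inner ℝ (τ s) (J n (T s)) : ℝ) ∧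
      inner ℝ (N s) (J n (T s)) = (0 : ℝ) ∧ inner ℝ (N s) (J n (τ s)) = (0 : ℝ) := by
  have h₁ : ∀ s ∈ I, inner ℝ (τ s) (J n (γ s)) = (0 : ℝ) := fun s hs => by
    have h := deriv_inner_J_eq_zero hI dT dγ hL s hs
    simpa [inner_sub_left, inner_J_self] using h
  have h₂ : ∀ s ∈ I, inner ℝ (N s) (J n (γ s)) = -(inner ℝ (τ s) (J n (T s)) : ℝ) :=
    fun s hs => by
      have h := deriv_inner_J_eq_zero hI dτ dγ h₁ s hs
      linarith
  -- The derivative of `⟨N, Jγ⟩ + ⟨τ, JT⟩ = 0` reduces to `2⟨N, JT⟩ = 0`.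
  have h₃ : ∀ s ∈ I, inner ℝ (N s) (J n (T s)) = (0 : ℝ) := fun s hs => by
    have d := ((dN s hs).inner ℝ
        ((J n).toContinuousLinearMap.hasFDerivAt.comp_hasDerivAt s (dγ s hs))).add
      ((dτ s hs).inner ℝ ((J n).toContinuousLinearMap.hasFDerivAt.comp_hasDerivAt s (dT s hs)))
    have e : (fun t => inner ℝ (N t) (J n (γ t)) + inner ℝ (τ t) (J n (T t))) =ᶠ[nhds s]
        fun _ => (0 : ℝ) :=
      Filter.eventually_of_mem (hI.mem_nhds hs) fun t ht => by
        simp only [h₂ t ht]; ring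
    have h := d.unique ((hasDerivAt_const s (0 : ℝ)).congr_of_eventuallyEq e)
    simp only [LinearMap.coe_toContinuousLinearMap', Function.comp_apply, map_sub,
      inner_sub_right, inner_sub_left, real_inner_smul_left, inner_J_self, h₁ s hs] at h
    linarith
  refine fun s hs => ⟨h₁ s hs, h₂ s hs, h₃ s hs, ?_⟩
  have h := deriv_inner_J_eq_zero hI dN dT h₃ s hs
  simp only [map_sub, inner_sub_right, inner_sub_left, real_inner_smul_left,
    inner_J_comm (γ s) (T s), hL s hs, h₂ s hs] at h
  linarith

/-- The components of a biharmonic curve in the two eigenspaces of its differential equation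
rotate: the sign of `b = ±κ⁻¹` selects the eigenspace. -/
theorem exists_rotating_component (hI : IsOpen I) (hI' : I.OrdConnected) {κ b A : ℝ}
    {T τ N : ℝ → E n} (hb : b ^ 2 * κ ^ 2 = 1) (hA : A ^ 2 = 1 + b * κ ^ 2) (hA0 : A ≠ 0)
    (dγ : ∀ s ∈ I, HasDerivAt γ (T s) s) (dT : ∀ s ∈ I, HasDerivAt T (τ s - γ s) s)
    (dτ : ∀ s ∈ I, HasDerivAt τ (N s) s)
    (dN : ∀ s ∈ I, HasDerivAt N (κ ^ 2 • γ s - τ s) s) (r : ℝ) :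
    ∃ e f : E n, ∀ s ∈ I,
      e = Real.cos (A * s) • (r • (γ s - b • τ s))
        - Real.sin (A * s) • ((r * A⁻¹) • (T s - b • N s)) ∧
      f = Real.sin (A * s) • (r • (γ s - b • τ s))
        + Real.cos (A * s) • ((r * A⁻¹) • (T s - b • N s)) := by
  have h₁ : A * A⁻¹ = 1 := mul_inv_cancel₀ hA0
  refine exists_rotating_frame hI hI' A (fun s hs => ?_) fun s hs => ?_
  · refine (((dγ s hs).sub ((dτ s hs).const_smul b)).const_smul r).congr_deriv ?_
    rw [smul_smul, show A * (r * A⁻¹) = r by linear_combination r * h₁]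
  · refine (((dT s hs).sub ((dN s hs).const_smul b)).const_smul (r * A⁻¹)).congr_deriv ?_
    have h₂ : A⁻¹ * (1 + b * κ ^ 2) = A := by rw [← hA]; linear_combination A * h₁
    -- The eigenvector condition `1 + b = b * (1 + b * κ ^ 2)`, equivalent to `b ^ 2 * κ ^ 2 = 1`.
    have h₃ : A⁻¹ * (1 + b) = A * b := by linear_combination b * h₂ - A⁻¹ * hb
    have h₄ : (r * A⁻¹) • (τ s - γ s - b • (κ ^ 2 • γ s - τ s))
        = (r * (A⁻¹ * (1 + b))) • τ s - (r * (A⁻¹ * (1 + b * κ ^ 2))) • γ s := by module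
    rw [h₄, h₂, h₃]
    module

/-! ### Assembling orthonormal families. -/

section Orthonormal

variable {V : Type*} [NormedAddCommGroup V] [InnerProductSpace ℝ V]

theorem orthonormal_vec4 {a b c d : V} (haa : inner ℝ a a = (1 : ℝ)) (hbb : inner ℝ b b = (1 : ℝ))
    (hcc : inner ℝ c c = (1 : ℝ)) (hdd : inner ℝ d d = (1 : ℝ)) (hab : inner ℝ a b = (0 : ℝ))
    (hac : inner ℝ a c = (0 : ℝ)) (had : inner ℝ a d = (0 : ℝ)) (hbc : inner ℝ b c = (0 : ℝ))
    (hbd : inner ℝ b d = (0 : ℝ)) (hcd : inner ℝ c d = (0 : ℝ)) :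
    Orthonormal ℝ ![a, b, c, d] := by
  have hba : inner ℝ b a = (0 : ℝ) := by rw [real_inner_comm, hab]
  have hca : inner ℝ c a = (0 : ℝ) := by rw [real_inner_comm, hac]
  have hda : inner ℝ d a = (0 : ℝ) := by rw [real_inner_comm, had]
  have hcb : inner ℝ c b = (0 : ℝ) := by rw [real_inner_comm, hbc]
  have hdb : inner ℝ d b = (0 : ℝ) := by rw [real_inner_comm, hbd]
  have hdc : inner ℝ d c = (0 : ℝ) := by rw [real_inner_comm, hcd]
  rw [orthonormal_iff_ite]
  intro i j
  fin_cases i <;> fin_cases j <;> first | assumption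

theorem orthonormal_vec6_J {a b c : E n} (haa : inner ℝ a a = (1 : ℝ))
    (hbb : inner ℝ b b = (1 : ℝ)) (hcc : inner ℝ c c = (1 : ℝ)) (hab : inner ℝ a b = (0 : ℝ))
    (hac : inner ℝ a c = (0 : ℝ)) (hbc : inner ℝ b c = (0 : ℝ))
    (jab : inner ℝ a (J n b) = (0 : ℝ)) (jac : inner ℝ a (J n c) = (0 : ℝ))
    (jbc : inner ℝ b (J n c) = (0 : ℝ)) :
    Orthonormal ℝ ![a, b, c, J n a, J n b, J n c] := by
  have hba : inner ℝ b a = (0 : ℝ) := by rw [real_inner_comm, hab]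
  have hca : inner ℝ c a = (0 : ℝ) := by rw [real_inner_comm, hac]
  have hcb : inner ℝ c b = (0 : ℝ) := by rw [real_inner_comm, hbc]
  have jba : inner ℝ b (J n a) = (0 : ℝ) := by rw [inner_J_comm, jab, neg_zero]
  have jca : inner ℝ c (J n a) = (0 : ℝ) := by rw [inner_J_comm, jac, neg_zero]
  have jcb : inner ℝ c (J n b) = (0 : ℝ) := by rw [inner_J_comm, jbc, neg_zero]
  rw [orthonormal_iff_ite]
  intro i j
  fin_cases i <;> fin_cases j <;>
    simp [J_J, inner_J_left, inner_J_self, -inner_self_eq_norm_sq_to_K, *]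

end Orthonormal

/-! ### Explicit parametrizations in the two curvature cases. -/

/-- The bound on the first curvature of a biharmonic curve, by the Cauchy-Schwarz inequality. -/
theorem firstCurvature_le_one {V : Type*} [NormedAddCommGroup V] [InnerProductSpace ℝ V]
    {κ : ℝ} {T N : V} (hκ : 0 < κ) (hTT : inner ℝ T T = (1 : ℝ))
    (hNT : inner ℝ N T = -κ ^ 2) (hNN : inner ℝ N N = κ ^ 2) : κ ≤ 1 := by
  have h := real_inner_mul_inner_self_le N T
  rw [hNT, hNN, hTT] at h
  have h' : κ ^ 2 * κ ^ 2 ≤ κ ^ 2 * 1 := by linarith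
  have := le_of_mul_le_mul_left h' (by positivity)
  nlinarith

/-- A biharmonic Legendre curve of first curvature one is a circle in a totally real space. -/
theorem exists_param_of_firstCurvature_eq_one (hI : IsOpen I) (hI' : I.OrdConnected)
    (hne : I.Nonempty) {T τ N : ℝ → E n} (hS : ∀ s ∈ I, inner ℝ (γ s) (γ s) = (1 : ℝ))
    (hT : ∀ s ∈ I, inner ℝ (T s) (T s) = (1 : ℝ))
    (dγ : ∀ s ∈ I, HasDerivAt γ (T s) s) (dT : ∀ s ∈ I, HasDerivAt T (τ s - γ s) s)
    (dτ : ∀ s ∈ I, HasDerivAt τ (N s) s)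
    (dN : ∀ s ∈ I, HasDerivAt N ((1 : ℝ) ^ 2 • γ s - τ s) s)
    (hL : ∀ s ∈ I, inner ℝ (T s) (J n (γ s)) = (0 : ℝ))
    (gram : ∀ s ∈ I, inner ℝ (T s) (γ s) = (0 : ℝ) ∧ inner ℝ (τ s) (γ s) = (0 : ℝ) ∧
        inner ℝ (τ s) (T s) = (0 : ℝ) ∧
        inner ℝ (τ s) (τ s) = (1 : ℝ) ^ 2 ∧ inner ℝ (N s) (γ s) = (0 : ℝ) ∧
        inner ℝ (N s) (T s) = -(1 : ℝ) ^ 2 ∧ inner ℝ (N s) (τ s) = (0 : ℝ) ∧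
        inner ℝ (N s) (N s) = (1 : ℝ) ^ 2) :
    ∃ e₁ e₂ e₃ : E n, Orthonormal ℝ ![e₁, e₂, e₃, J n e₁, J n e₂, J n e₃] ∧
      ∀ s ∈ I, γ s = (1 / √2 * Real.cos (√2 * s)) • e₁ + (1 / √2 * Real.sin (√2 * s)) • e₂
        + (1 / √2) • e₃ := by
  -- Equality in Cauchy-Schwarz: `|N + T|² = 1 - 2 + 1 = 0`.
  have hN : ∀ s ∈ I, N s = -T s := fun s hs => by
    obtain ⟨-, -, -, -, -, hNT, -, hNN⟩ := gram s hs
    rw [eq_neg_iff_add_eq_zero, ← inner_self_eq_zero (𝕜 := ℝ), inner_add_add_self,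
      real_inner_comm (N s) (T s), hNT, hNN, hT s hs]
    norm_num
  have h2 : √2 ^ 2 = 2 := Real.sq_sqrt (by norm_num)
  have h20 : √2 ≠ 0 := by positivity
  have hr : (√2)⁻¹ ^ 2 = 1 / 2 := by rw [inv_pow, h2]; norm_num
  obtain ⟨e₁, e₂, he⟩ := exists_rotating_component hI hI' (b := 1) (A := √2) (by norm_num)
    (by rw [h2]; norm_num) h20 dγ dT dτ dN (√2)⁻¹
  -- The eigenvalue `-(1 - κ)` is now zero; since `N = -T`, the second component does not move.
  obtain ⟨e₃, he₃⟩ := exists_const_of_hasDerivAt_zero hI hI'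
    (f := fun s => (√2)⁻¹ • (γ s + τ s)) fun s hs =>
      (((dγ s hs).add (dτ s hs)).const_smul (√2)⁻¹).congr_deriv (by rw [hN s hs]; simp)
  refine ⟨e₁, e₂, e₃, ?_, fun s hs => ?_⟩
  · obtain ⟨s, hs⟩ := hne
    obtain ⟨hTγ, hτγ, hτT, hττ, -, -, -, -⟩ := gram s hs
    obtain ⟨jτγ, jNγ, -, -⟩ := inner_J_frame hI dγ dT dτ dN hL s hs
    have jTγ := hL s hs
    obtain ⟨h₁, h₂⟩ := he s hs
    have h₃ := (he₃ s hs).symm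
    have hw : ((√2)⁻¹ * (√2)⁻¹) • (T s - (1 : ℝ) • N s) = T s := by
      rw [← sq, hr, hN s hs]; module
    rw [hw, one_smul] at h₁ h₂
    -- The one free Kähler pairing equals `-⟨N, Jγ⟩ = ⟨T, Jγ⟩`, which the Legendre condition kills;
    -- hence the span is totally real.
    have jτT : inner ℝ (τ s) (J n (T s)) = (0 : ℝ) := by
      rw [hN s hs, inner_neg_left, jTγ] at jNγ
      linarith
    have hγγ := hS s hs
    have hTT := hT s hs
    have hγT : inner ℝ (γ s) (T s) = (0 : ℝ) := by rw [real_inner_comm, hTγ]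
    have hγτ : inner ℝ (γ s) (τ s) = (0 : ℝ) := by rw [real_inner_comm, hτγ]
    have hTτ : inner ℝ (T s) (τ s) = (0 : ℝ) := by rw [real_inner_comm, hτT]
    have jγT : inner ℝ (γ s) (J n (T s)) = (0 : ℝ) := by rw [inner_J_comm, jTγ, neg_zero]
    have jγτ : inner ℝ (γ s) (J n (τ s)) = (0 : ℝ) := by rw [inner_J_comm, jτγ, neg_zero]
    have jTτ : inner ℝ (T s) (J n (τ s)) = (0 : ℝ) := by rw [inner_J_comm, jτT, neg_zero]
    obtain ⟨u, hu⟩ : ∃ u, u = (√2)⁻¹ • (γ s - τ s) := ⟨_, rfl⟩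
    rw [← hu] at h₁ h₂
    have uu : inner ℝ u u = (1 : ℝ) := by
      simp only [hu, inner_sub_left, inner_sub_right, real_inner_smul_left,
        real_inner_smul_right, hγγ, hττ, hγτ, hτγ]
      linear_combination 2 * hr
    have uT : inner ℝ u (T s) = (0 : ℝ) := by
      simp [hu, inner_sub_left, real_inner_smul_left, hγT, hτT]
    have ue : inner ℝ u e₃ = (0 : ℝ) := by
      simp only [hu, h₃, inner_sub_left, inner_add_right, real_inner_smul_left,
        real_inner_smul_right, hγγ, hττ, hγτ, hτγ]
      ring
    have Te : inner ℝ (T s) e₃ = (0 : ℝ) := by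
      simp [h₃, inner_add_right, real_inner_smul_right, hTγ, hTτ]
    have ee : inner ℝ e₃ e₃ = (1 : ℝ) := by
      simp only [h₃, inner_add_left, inner_add_right, real_inner_smul_left,
        real_inner_smul_right, hγγ, hττ, hγτ, hτγ]
      linear_combination 2 * hr
    have juT : inner ℝ u (J n (T s)) = (0 : ℝ) := by
      simp [hu, inner_sub_left, real_inner_smul_left, jγT, jτT]
    have jue : inner ℝ u (J n e₃) = (0 : ℝ) := by
      simp [hu, h₃, inner_sub_left, inner_add_right, real_inner_smul_left,
        real_inner_smul_right, inner_J_self, jγτ, jτγ]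
    have jTe : inner ℝ (T s) (J n e₃) = (0 : ℝ) := by
      simp [h₃, inner_add_right, real_inner_smul_right, jTγ, jTτ]
    obtain ⟨h₁₁, h₂₂, h₁₂⟩ := orthonormal_frame h₁ h₂ uu hTT uT
    obtain ⟨h₁₃, h₂₃⟩ := inner_frame_eq_zero h₁ h₂ ue Te
    obtain ⟨j₁₃, j₂₃⟩ := inner_frame_eq_zero h₁ h₂ jue jTe
    exact orthonormal_vec6_J h₁₁ h₂₂ ee h₁₂ h₁₃ h₂₃ (by rw [inner_J_frame_pair h₁ h₂, juT])
      j₁₃ j₂₃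
  · have h := cos_smul_add_sin_smul_frame (he s hs).1 (he s hs).2
    have h' : (√2)⁻¹ • ((√2)⁻¹ • (γ s - (1 : ℝ) • τ s) + (√2)⁻¹ • (γ s + τ s)) = γ s := by
      rw [smul_add, smul_smul, smul_smul, ← sq, hr]
      module
    rw [← h, he₃ s hs] at h'
    rw [← h']
    module

set_option linter.unusedSimpArgs false in
/-- A biharmonic Legendre curve of first curvature less than one is a sum of two rotations in
orthogonal planes. -/
theorem exists_param_of_firstCurvature_lt_one (hI : IsOpen I) (hI' : I.OrdConnected)
    (hne : I.Nonempty) {κ A B : ℝ} {T τ N : ℝ → E n} (hκ : 0 < κ) (hA : 0 < A) (hB : 0 < B)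
    (hA2 : A ^ 2 = 1 + κ) (hB2 : B ^ 2 = 1 - κ)
    (hS : ∀ s ∈ I, inner ℝ (γ s) (γ s) = (1 : ℝ))
    (hT : ∀ s ∈ I, inner ℝ (T s) (T s) = (1 : ℝ))
    (dγ : ∀ s ∈ I, HasDerivAt γ (T s) s) (dT : ∀ s ∈ I, HasDerivAt T (τ s - γ s) s)
    (dτ : ∀ s ∈ I, HasDerivAt τ (N s) s)
    (dN : ∀ s ∈ I, HasDerivAt N (κ ^ 2 • γ s - τ s) s)
    (hL : ∀ s ∈ I, inner ℝ (T s) (J n (γ s)) = (0 : ℝ))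
    (gram : ∀ s ∈ I, inner ℝ (T s) (γ s) = (0 : ℝ) ∧ inner ℝ (τ s) (γ s) = (0 : ℝ) ∧
        inner ℝ (τ s) (T s) = (0 : ℝ) ∧
        inner ℝ (τ s) (τ s) = κ ^ 2 ∧ inner ℝ (N s) (γ s) = (0 : ℝ) ∧
        inner ℝ (N s) (T s) = -κ ^ 2 ∧ inner ℝ (N s) (τ s) = (0 : ℝ) ∧
        inner ℝ (N s) (N s) = κ ^ 2) :
    ∃ e₁ e₂ e₃ e₄ : E n, Orthonormal ℝ ![e₁, e₂, e₃, e₄] ∧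
      inner ℝ e₁ (J n e₃) = (0 : ℝ) ∧ inner ℝ e₁ (J n e₄) = (0 : ℝ) ∧
      inner ℝ e₂ (J n e₃) = (0 : ℝ) ∧ inner ℝ e₂ (J n e₄) = (0 : ℝ) ∧
      A * inner ℝ e₁ (J n e₂) + B * inner ℝ e₃ (J n e₄) = 0 ∧
      ∀ s ∈ I, γ s = (1 / √2 * Real.cos (A * s)) • e₁ + (1 / √2 * Real.sin (A * s)) • e₂
        + (1 / √2 * Real.cos (B * s)) • e₃ + (1 / √2 * Real.sin (B * s)) • e₄ := by
  have h2 : √2 ^ 2 = 2 := Real.sq_sqrt (by norm_num)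
  have hr : (√2)⁻¹ ^ 2 = 1 / 2 := by rw [inv_pow, h2]; norm_num
  obtain ⟨a, ha⟩ : ∃ a, a = κ⁻¹ := ⟨_, rfl⟩
  have haκ : a * κ = 1 := by rw [ha, inv_mul_cancel₀ hκ.ne']
  -- The choices `b = a` and `b = -a` give the eigenvalues `-A²` and `-B²`. The scale `1/√2`
  -- normalizes, because `|γ ∓ a τ|² = 1 + a²κ² = 2`.
  obtain ⟨e₁, e₂, he⟩ := exists_rotating_component hI hI' (b := a) (A := A)
    (by linear_combination (a * κ + 1) * haκ) (by linear_combination hA2 - κ * haκ) hA.ne'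
    dγ dT dτ dN (√2)⁻¹
  obtain ⟨e₃, e₄, he'⟩ := exists_rotating_component hI hI' (b := -a) (A := B)
    (by linear_combination (a * κ + 1) * haκ) (by linear_combination hB2 + κ * haκ) hB.ne'
    dγ dT dτ dN (√2)⁻¹
  refine ⟨e₁, e₂, e₃, e₄, ?_⟩
  -- Separates the relations among the constant vectors, checked at a single `s`, from the formula
  -- for `γ`, needed at every `s`.
  rw [← and_assoc, ← and_assoc, ← and_assoc, ← and_assoc, ← and_assoc]
  constructor
  · obtain ⟨s, hs⟩ := hne
    obtain ⟨hTγ, hτγ, hτT, hττ, hNγ, hNT, hNτ, hNN⟩ := gram s hs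
    obtain ⟨jτγ, jNγ, jNT, jNτ⟩ := inner_J_frame hI dγ dT dτ dN hL s hs
    have jTγ := hL s hs
    have hγγ := hS s hs
    have hTT := hT s hs
    obtain ⟨h₁, h₂⟩ := he s hs
    obtain ⟨h₃, h₄⟩ := he' s hs
    have hγT : inner ℝ (γ s) (T s) = (0 : ℝ) := by rw [real_inner_comm, hTγ]
    have hγτ : inner ℝ (γ s) (τ s) = (0 : ℝ) := by rw [real_inner_comm, hτγ]
    have hTτ : inner ℝ (T s) (τ s) = (0 : ℝ) := by rw [real_inner_comm, hτT]
    have hγN : inner ℝ (γ s) (N s) = (0 : ℝ) := by rw [real_inner_comm, hNγ]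
    have hτN : inner ℝ (τ s) (N s) = (0 : ℝ) := by rw [real_inner_comm, hNτ]
    have hTN : inner ℝ (T s) (N s) = -κ ^ 2 := by rw [real_inner_comm, hNT]
    have jγT : inner ℝ (γ s) (J n (T s)) = (0 : ℝ) := by rw [inner_J_comm, jTγ, neg_zero]
    have jγτ : inner ℝ (γ s) (J n (τ s)) = (0 : ℝ) := by rw [inner_J_comm, jτγ, neg_zero]
    have jTN : inner ℝ (T s) (J n (N s)) = (0 : ℝ) := by rw [inner_J_comm, jNT, neg_zero]
    have jτN : inner ℝ (τ s) (J n (N s)) = (0 : ℝ) := by rw [inner_J_comm, jNτ, neg_zero]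
    have jTτ := inner_J_comm (T s) (τ s)
    have jγN : inner ℝ (γ s) (J n (N s)) = inner ℝ (τ s) (J n (T s)) := by
      rw [inner_J_comm, jNγ, neg_neg]
    have hAA : A⁻¹ ^ 2 * (1 + κ) = 1 := by
      rw [← hA2, ← mul_pow, inv_mul_cancel₀ hA.ne', one_pow]
    have hBB : B⁻¹ ^ 2 * (1 - κ) = 1 := by
      rw [← hB2, ← mul_pow, inv_mul_cancel₀ hB.ne', one_pow]
    obtain ⟨u, hu⟩ : ∃ u, u = (√2)⁻¹ • (γ s - a • τ s) := ⟨_, rfl⟩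
    obtain ⟨w, hw⟩ : ∃ w, w = ((√2)⁻¹ * A⁻¹) • (T s - a • N s) := ⟨_, rfl⟩
    obtain ⟨x, hx⟩ : ∃ x, x = (√2)⁻¹ • (γ s - -a • τ s) := ⟨_, rfl⟩
    obtain ⟨y, hy⟩ : ∃ y, y = ((√2)⁻¹ * B⁻¹) • (T s - -a • N s) := ⟨_, rfl⟩
    rw [← hu, ← hw] at h₁ h₂
    rw [← hx, ← hy] at h₃ h₄
    have haκ2 : a ^ 2 * κ ^ 2 = 1 := by linear_combination (a * κ + 1) * haκ
    have haκ1 : a * κ ^ 2 = κ := by linear_combination κ * haκ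
    have uu : inner ℝ u u = (1 : ℝ) := by
      simp only [hu, hw, hx, hy, inner_sub_left, inner_sub_right, real_inner_smul_left,
        real_inner_smul_right, map_sub, map_smul, 
        hγγ, hTT, hττ, hNN, hγT, hTγ, hγτ, hτγ, hγN, hNγ, hτT, hTτ,
        hτN, hNτ, hTN, hNT]
      linear_combination (1 + a ^ 2 * κ ^ 2) * hr + (1 / 2) * haκ2
    have xx : inner ℝ x x = (1 : ℝ) := by
      simp only [hu, hw, hx, hy, inner_sub_left, inner_sub_right, real_inner_smul_left,
        real_inner_smul_right, map_sub, map_smul, 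
        hγγ, hTT, hττ, hNN, hγT, hTγ, hγτ, hτγ, hγN, hNγ, hτT, hTτ,
        hτN, hNτ, hTN, hNT]
      linear_combination (1 + a ^ 2 * κ ^ 2) * hr + (1 / 2) * haκ2
    have ww : inner ℝ w w = (1 : ℝ) := by
      simp only [hu, hw, hx, hy, inner_sub_left, inner_sub_right, real_inner_smul_left,
        real_inner_smul_right, map_sub, map_smul, 
        hγγ, hTT, hττ, hNN, hγT, hTγ, hγτ, hτγ, hγN, hNγ, hτT, hTτ,
        hτN, hNτ, hTN, hNT]
      linear_combination A⁻¹ ^ 2 * (1 + 2 * a * κ ^ 2 + a ^ 2 * κ ^ 2) * hr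
        + (1 / 2) * A⁻¹ ^ 2 * (2 * haκ1 + haκ2) + hAA
    have yy : inner ℝ y y = (1 : ℝ) := by
      simp only [hu, hw, hx, hy, inner_sub_left, inner_sub_right, real_inner_smul_left,
        real_inner_smul_right, map_sub, map_smul, 
        hγγ, hTT, hττ, hNN, hγT, hTγ, hγτ, hτγ, hγN, hNγ, hτT, hTτ,
        hτN, hNτ, hTN, hNT]
      linear_combination B⁻¹ ^ 2 * (1 - 2 * a * κ ^ 2 + a ^ 2 * κ ^ 2) * hr
        + (1 / 2) * B⁻¹ ^ 2 * (-2 * haκ1 + haκ2) + hBB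
    have uw : inner ℝ u w = (0 : ℝ) := by
      simp only [hu, hw, hx, hy, inner_sub_left, inner_sub_right, real_inner_smul_left,
        real_inner_smul_right, map_sub, map_smul, 
        hγγ, hTT, hττ, hNN, hγT, hTγ, hγτ, hτγ, hγN, hNγ, hτT, hTτ,
        hτN, hNτ, hTN, hNT]
      ring
    have xy : inner ℝ x y = (0 : ℝ) := by
      simp only [hu, hw, hx, hy, inner_sub_left, inner_sub_right, real_inner_smul_left,
        real_inner_smul_right, map_sub, map_smul, 
        hγγ, hTT, hττ, hNN, hγT, hTγ, hγτ, hτγ, hγN, hNγ, hτT, hTτ,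
        hτN, hNτ, hTN, hNT]
      ring
    have uy : inner ℝ u y = (0 : ℝ) := by
      simp only [hu, hw, hx, hy, inner_sub_left, inner_sub_right, real_inner_smul_left,
        real_inner_smul_right, map_sub, map_smul, 
        hγγ, hTT, hττ, hNN, hγT, hTγ, hγτ, hτγ, hγN, hNγ, hτT, hTτ,
        hτN, hNτ, hTN, hNT]
      ring
    have wx : inner ℝ w x = (0 : ℝ) := by
      simp only [hu, hw, hx, hy, inner_sub_left, inner_sub_right, real_inner_smul_left,
        real_inner_smul_right, map_sub, map_smul, 
        hγγ, hTT, hττ, hNN, hγT, hTγ, hγτ, hτγ, hγN, hNγ, hτT, hTτ,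
        hτN, hNτ, hTN, hNT]
      ring
    have ux : inner ℝ u x = (0 : ℝ) := by
      simp only [hu, hw, hx, hy, inner_sub_left, inner_sub_right, real_inner_smul_left,
        real_inner_smul_right, map_sub, map_smul, 
        hγγ, hTT, hττ, hNN, hγT, hTγ, hγτ, hτγ, hγN, hNγ, hτT, hTτ,
        hτN, hNτ, hTN, hNT]
      linear_combination -(√2)⁻¹ ^ 2 * haκ2
    have wy : inner ℝ w y = (0 : ℝ) := by
      simp only [hu, hw, hx, hy, inner_sub_left, inner_sub_right, real_inner_smul_left,
        real_inner_smul_right, map_sub, map_smul, 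
        hγγ, hTT, hττ, hNN, hγT, hTγ, hγτ, hτγ, hγN, hNγ, hτT, hTτ,
        hτN, hNτ, hTN, hNT]
      linear_combination -(√2)⁻¹ ^ 2 * A⁻¹ * B⁻¹ * haκ2
    have jux : inner ℝ u (J n x) = (0 : ℝ) := by
      simp only [hu, hw, hx, hy, inner_sub_left, inner_sub_right, real_inner_smul_left,
        real_inner_smul_right, map_sub, map_smul, 
        inner_J_self, jγT,
        jTγ, jγτ, jτγ, jγN, jNγ, jTτ, jTN, jNT, jτN, jNτ]
      ring
    have juy : inner ℝ u (J n y) = (0 : ℝ) := by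
      simp only [hu, hw, hx, hy, inner_sub_left, inner_sub_right, real_inner_smul_left,
        real_inner_smul_right, map_sub, map_smul, 
        inner_J_self, jγT,
        jTγ, jγτ, jτγ, jγN, jNγ, jTτ, jTN, jNT, jτN, jNτ]
      ring
    have jwx : inner ℝ w (J n x) = (0 : ℝ) := by
      simp only [hu, hw, hx, hy, inner_sub_left, inner_sub_right, real_inner_smul_left,
        real_inner_smul_right, map_sub, map_smul, 
        inner_J_self, jγT,
        jTγ, jγτ, jτγ, jγN, jNγ, jTτ, jTN, jNT, jτN, jNτ]
      ring
    have jwy : inner ℝ w (J n y) = (0 : ℝ) := by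
      simp only [hu, hw, hx, hy, inner_sub_left, inner_sub_right, real_inner_smul_left,
        real_inner_smul_right, map_sub, map_smul, 
        inner_J_self, jγT,
        jTγ, jγτ, jτγ, jγN, jNγ, jTτ, jTN, jNT, jτN, jNτ]
      ring
    -- The factors `A` and `B` cancel the `A⁻¹` and `B⁻¹` in `w` and `y`, leaving `-a⟨τ, JT⟩` and
    -- `+a⟨τ, JT⟩`.
    have jsum : A * inner ℝ u (J n w) + B * inner ℝ x (J n y) = 0 := by
      simp only [hu, hw, hx, hy, inner_sub_left, inner_sub_right, real_inner_smul_left,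
        real_inner_smul_right, map_sub, map_smul, 
        inner_J_self, jγT,
        jTγ, jγτ, jτγ, jγN, jNγ, jTτ, jTN, jNT, jτN, jNτ]
      linear_combination -2 * a * (√2)⁻¹ ^ 2 * (inner ℝ (τ s) (J n (T s)) : ℝ)
        * (mul_inv_cancel₀ hA.ne' - mul_inv_cancel₀ hB.ne')
    obtain ⟨h₁₁, h₂₂, h₁₂⟩ := orthonormal_frame h₁ h₂ uu ww uw
    obtain ⟨h₃₃, h₄₄, h₃₄⟩ := orthonormal_frame h₃ h₄ xx yy xy
    -- Passes orthogonality from `x, y` to `e₃, e₄` in the second slot; `combJ` does so for the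
    -- Kähler form by antisymmetry.
    have comb : ∀ z : E n, inner ℝ z x = (0 : ℝ) → inner ℝ z y = (0 : ℝ) →
        inner ℝ z e₃ = (0 : ℝ) ∧ inner ℝ z e₄ = (0 : ℝ) := fun z hzx hzy => by
      rw [real_inner_comm] at hzx hzy
      have h := inner_frame_eq_zero h₃ h₄ hzx hzy
      rwa [real_inner_comm, real_inner_comm z e₄] at h
    have combJ : ∀ z : E n, inner ℝ z (J n x) = (0 : ℝ) → inner ℝ z (J n y) = (0 : ℝ) →
        inner ℝ z (J n e₃) = (0 : ℝ) ∧ inner ℝ z (J n e₄) = (0 : ℝ) := fun z hzx hzy => by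
      rw [inner_J_comm, neg_eq_zero] at hzx hzy
      have h := inner_frame_eq_zero h₃ h₄ hzx hzy
      rwa [inner_J_comm, neg_eq_zero, inner_J_comm e₄, neg_eq_zero] at h
    obtain ⟨hu₃, hu₄⟩ := comb u ux uy
    obtain ⟨hw₃, hw₄⟩ := comb w wx wy
    obtain ⟨ju₃, ju₄⟩ := combJ u jux juy
    obtain ⟨jw₃, jw₄⟩ := combJ w jwx jwy
    obtain ⟨h₁₃, h₂₃⟩ := inner_frame_eq_zero h₁ h₂ hu₃ hw₃
    obtain ⟨h₁₄, h₂₄⟩ := inner_frame_eq_zero h₁ h₂ hu₄ hw₄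
    obtain ⟨j₁₃, j₂₃⟩ := inner_frame_eq_zero h₁ h₂ ju₃ jw₃
    obtain ⟨j₁₄, j₂₄⟩ := inner_frame_eq_zero h₁ h₂ ju₄ jw₄
    refine ⟨⟨⟨⟨⟨orthonormal_vec4 h₁₁ h₂₂ h₃₃ h₄₄ h₁₂ h₁₃ h₁₄ h₂₃ h₂₄ h₃₄, j₁₃⟩, j₁₄⟩, j₂₃⟩,
      j₂₄⟩, ?_⟩
    rw [inner_J_frame_pair h₁ h₂, inner_J_frame_pair h₃ h₄, jsum]
  · intro s hs
    have h := cos_smul_add_sin_smul_frame (he s hs).1 (he s hs).2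
    have h' := cos_smul_add_sin_smul_frame (he' s hs).1 (he' s hs).2
    have h₅ : (√2)⁻¹ • ((√2)⁻¹ • (γ s - a • τ s) + (√2)⁻¹ • (γ s - -a • τ s)) = γ s := by
      rw [smul_add, smul_smul, smul_smul, ← sq, hr]
      module
    rw [← h, ← h'] at h₅
    rw [← h₅]
    module

end LegendreSphere

theorem mainTheorem5 (n : ℕ) (hn : 2 ≤ n) (I : Set ℝ) (hI_open : IsOpen I)
    (hI_interval : I.OrdConnected) (γ : ℝ → LegendreSphere.E n)
    (hγ_smooth : ContDiffOn ℝ ∞ γ I)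
    (hγ_sphere : ∀ s ∈ I, γ s ∈ Metric.sphere (0 : LegendreSphere.E n) 1)
    (hγ_arclength : ∀ s ∈ I, ‖deriv γ s‖ = 1)
    (hγ_legendre : LegendreSphere.IsLegendre γ I)
    (hγ_biharmonic : LegendreSphere.IsProperBiharmonic γ I) :
    (∃ e₁ e₂ e₃ : LegendreSphere.E n,
      Orthonormal ℝ ![e₁, e₂, e₃, LegendreSphere.J n e₁, LegendreSphere.J n e₂,
        LegendreSphere.J n e₃] ∧
      ∀ s ∈ I, γ s = (1 / √2 * Real.cos (√2 * s)) • e₁ + (1 / √2 * Real.sin (√2 * s)) • e₂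
        + (1 / √2) • e₃) ∨
    (∃ (κ₁ A B : ℝ) (e₁ e₂ e₃ e₄ : LegendreSphere.E n),
      κ₁ ∈ Set.Ioo (0 : ℝ) 1 ∧ (∀ s ∈ I, LegendreSphere.firstCurvature γ s = κ₁) ∧
      A = √(1 + κ₁) ∧ B = √(1 - κ₁) ∧
      Orthonormal ℝ ![e₁, e₂, e₃, e₄] ∧
      inner ℝ e₁ (LegendreSphere.J n e₃) = 0 ∧ inner ℝ e₁ (LegendreSphere.J n e₄) = 0 ∧
      inner ℝ e₂ (LegendreSphere.J n e₃) = 0 ∧ inner ℝ e₂ (LegendreSphere.J n e₄) = 0 ∧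
      A * inner ℝ e₁ (LegendreSphere.J n e₂) + B * inner ℝ e₃ (LegendreSphere.J n e₄) = 0 ∧
      ∀ s ∈ I, γ s = (1 / √2 * Real.cos (A * s)) • e₁ + (1 / √2 * Real.sin (A * s)) • e₂
        + (1 / √2 * Real.cos (B * s)) • e₃ + (1 / √2 * Real.sin (B * s)) • e₄) := by
  have hS : ∀ s ∈ I, inner ℝ (γ s) (γ s) = (1 : ℝ) := fun s hs => by
    rw [real_inner_self_eq_norm_sq, mem_sphere_zero_iff_norm.1 (hγ_sphere s hs), one_pow]
  have hT : ∀ s ∈ I, inner ℝ (deriv γ s) (deriv γ s) = (1 : ℝ) := fun s hs => by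
    rw [real_inner_self_eq_norm_sq, hγ_arclength s hs, one_pow]
  have hL : ∀ s ∈ I, inner ℝ (deriv γ s) (LegendreSphere.J n (γ s)) = (0 : ℝ) := fun s hs => by
    simpa [LegendreSphere.contactForm, LegendreSphere.reeb] using hγ_legendre s hs
  obtain ⟨hb, hh⟩ := hγ_biharmonic
  simp only [LegendreSphere.IsHarmonic, not_forall] at hh
  obtain ⟨s₀, hs₀, hτ₀⟩ := hh
  obtain ⟨κ, N, hκ, hfirst, dγ, dT, dτ, dN, gram⟩ := LegendreSphere.exists_frame_equations
    hI_open hI_interval ⟨s₀, hs₀⟩ hγ_smooth hS hT hb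
  -- The curvature is constant, so one non-harmonic point makes it positive everywhere.
  have hκ0 : 0 < κ := by
    rw [← hfirst s₀ hs₀]
    exact norm_pos_iff.2 hτ₀
  obtain ⟨-, -, -, -, -, hNT, -, hNN⟩ := gram s₀ hs₀
  rcases (LegendreSphere.firstCurvature_le_one hκ0 (hT s₀ hs₀) hNT hNN).eq_or_lt with rfl | h1
  · exact Or.inl (LegendreSphere.exists_param_of_firstCurvature_eq_one hI_open hI_interval
      ⟨s₀, hs₀⟩ hS hT dγ dT dτ dN hL gram)
  · obtain ⟨e₁, e₂, e₃, e₄, h⟩ := LegendreSphere.exists_param_of_firstCurvature_lt_one hI_open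
      hI_interval ⟨s₀, hs₀⟩ hκ0 (A := √(1 + κ)) (B := √(1 - κ)) (Real.sqrt_pos.2 (by linarith))
      (Real.sqrt_pos.2 (by linarith)) (Real.sq_sqrt (by linarith)) (Real.sq_sqrt (by linarith))
      hS hT dγ dT dτ dN hL gram
    exact Or.inr ⟨κ, _, _, e₁, e₂, e₃, e₄, ⟨hκ0, h1⟩, hfirst, rfl, rfl, h⟩
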